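/- All graphs are finite and simple. For an edge $e=uv$ of a graph $G$, let the closed neighbourhood $E[e]$ be the set of all edges of $G$ incident with $u$ or $v$ (so $e\in E[e]$), and let the open neighbourhood be $E(e)=E[e]\setminus\{e\}$; the edge $e$ is isolated if $E(e)=\emptyset$. A colouring of all edges of $G$ (not necessarily proper) is called conflict-free if for every non-isolated edge $e$ there is a colour that appears on some edge $e'\in E(e)$ and on no edge of $E[e]\setminus\{e'\}$. Let $\chi'_{\rm cf}(G)$ be the minimum number of colours in a conflict-free colouring of all edges of $G$. Theorem. For every $\varepsilon>0$ there exists $\Delta_\varepsilon$ such that every graph $G$ with maximum degree $\Delta\ge\Delta_\varepsilon$ satisfies $$\chi'_{\rm cf}(G)\le(1+\varepsilon)\log_2\Delta .$$ -/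

import Mathlib

namespace ConflictFree

variable {V : Type*} {G : SimpleGraph V}

/-- The closed neighbourhood `E[e]` of an edge `e = uv`: all edges incident with `u` or `v`
(including `e` itself). -/
def closedNbhd (e : G.edgeSet) : Set G.edgeSet :=
  {f | ∃ v : V, v ∈ (e : Sym2 V) ∧ v ∈ (f : Sym2 V)}

/-- The open neighbourhood `E(e) = E[e] \ {e}` of an edge `e`. -/
def openNbhd (e : G.edgeSet) : Set G.edgeSet :=
  closedNbhd e \ {e}

/-- The colour `α` is unique for the edge `e`: it appears on some edge `e'` of the open
neighbourhood of `e`, and on no other edge of the closed neighbourhood of `e`. -/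
def IsUniqueColour {C : Type*} (c : G.edgeSet → C) (e : G.edgeSet) (α : C) : Prop :=
  ∃ e' ∈ openNbhd e, c e' = α ∧ ∀ e'' ∈ closedNbhd e, e'' ≠ e' → c e'' ≠ α

/-- An edge is satisfied by the colouring `c` if some colour is unique for it. -/
def IsSatisfied {C : Type*} (c : G.edgeSet → C) (e : G.edgeSet) : Prop :=
  ∃ α : C, IsUniqueColour c e α

/-- A colouring of all edges of `G` is conflict-free if every non-isolated edge is satisfied. -/
def IsConflictFree {C : Type*} (c : G.edgeSet → C) : Prop :=
  ∀ e : G.edgeSet, (openNbhd e).Nonempty → IsSatisfied c e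

/-- The conflict-free chromatic index of `G`: the minimum number of colours in a conflict-free
colouring of all edges of `G`. -/
noncomputable def chromaticIndex (G : SimpleGraph V) : ℕ :=
  sInf {k : ℕ | ∃ c : G.edgeSet → Fin k, IsConflictFree c}

/-- An injective colouring is conflict-free. -/
theorem isConflictFree_of_injective {C : Type*} (c : G.edgeSet → C)
    (hc : Function.Injective c) : IsConflictFree c := by
  rintro e ⟨f, hf⟩
  exact ⟨c f, f, hf, rfl, fun g _ hg h => hg (hc h)⟩

/-- For a finite graph the minimum defining the index is taken over a nonempty set, and so it is
attained. -/
theorem exists_isConflictFree_chromaticIndex [Finite V] (G : SimpleGraph V) :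
    ∃ c : G.edgeSet → Fin (chromaticIndex G), IsConflictFree c := by
  obtain ⟨n, ⟨φ⟩⟩ := Finite.exists_equiv_fin G.edgeSet
  exact Nat.sInf_mem
    (s := {k : ℕ | ∃ c : G.edgeSet → Fin k, IsConflictFree c})
    ⟨n, φ, isConflictFree_of_injective _ φ.injective⟩

end ConflictFree

/-!
Why the theorem is true. Call an edge `uv` *hit once* by a set `T` of edges if exactly one edge of
`T` meets `{u, v}` and this edge is not `uv` (`HitsOnce`). If `T` is a colour class, then `uv` is
satisfied; and it stays satisfied when `T` is split into several colours. So refining a colouring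
never does harm.

The leading term comes from matchings (`exists_separating_matchings`). Let `A` be a graph properly
coloured with `2 ^ (k + 1) + 1` colours, let `S` be the union of `2 ^ k + 1` of the colour classes,
and let `N` be a maximal matching of `A[S]`. An edge with exactly one end covered by `N` is hit once
by `N`, so only edges with both or neither end covered remain. The covered vertices carry
`2 ^ k + 1` colours, and so do the uncovered ones, after recolouring: the uncovered part
of `S` is independent, hence a single class next to the `2 ^ k` classes outside `S`. Thus one
matching halves the number of colours. Starting from a colouring with `2 * Δ + 1` colours, after
`k = log₂ Δ + O(1)` disjoint matchings the edges not yet treated are the edges of the matchings and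
the edges of one bipartite graph.

These leftovers are handled by cuts. For a set `S` of vertices of degree at least two in a graph
`W`, four sets of edges of `W` hit every pair between `S` and its complement once
(`exists_edge_classes_of_cut`). A graph of chromatic number at most `2 ^ Q` is covered by `Q` cuts,
so it costs `O(Q)` colours, provided that each cut has its own graph `W`. By Hall's theorem, vertices
of degree at least `4 * (Q + 2)` can reserve two of their edges for each of `Q + 2` cuts
(`exists_injective_incident_edges`). The matchings avoid the reserved edges, and the graph of all
edges that are reserved or in a matching has an orientation of outdegree at most
`k + 2 * (Q + 2)`, hence chromatic number `O(k + Q)`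
(`exists_colouring_of_card_out_le`), so that `Q = log₂ k + O(1)` is enough. One further cut is for
the leftover bipartite graph, and one for the edges between large and small degree.

Finally, edges between two vertices of small degree are satisfied by a separate colouring with
`O(Q ^ 2)` colours (`exists_colouring_of_degree_le`), which refines the previous one outside the
matchings. The total is `k + O(Q ^ 3) = (1 + o(1)) log₂ Δ`.
-/

namespace ConflictFree


/-! ### Colouring sparse orientations -/

/-- If every element has at most `m` out-neighbours, then `2 * m + 1` colours suffice to separate
all elements from their out-neighbours: some element of any finite set has at most `2 * m`
neighbours in it, by averaging, and it can be coloured last. -/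
theorem exists_colouring_of_card_out_le {α : Type*} [Finite α] (out : α → Finset α) (m : ℕ)
    (hout : ∀ a, (out a).card ≤ m) :
    ∃ c : α → Fin (2 * m + 1), ∀ a, ∀ b ∈ out a, b ≠ a → c a ≠ c b := by
  classical
  have := Fintype.ofFinite α
  suffices H : ∀ s : Finset α, ∃ c : α → Fin (2 * m + 1),
      ∀ a ∈ s, ∀ b ∈ s, b ∈ out a → b ≠ a → c a ≠ c b by
    obtain ⟨c, hc⟩ := H Finset.univ
    exact ⟨c, fun a b hb hne => hc a (Finset.mem_univ _) b (Finset.mem_univ _) hb hne⟩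
  intro s
  induction s using Finset.strongInduction with
  | H s ih =>
    rcases s.eq_empty_or_nonempty with rfl | hs
    · exact ⟨fun _ => 0, by simp⟩
    obtain ⟨a, ha, hdeg⟩ : ∃ a ∈ s,
        (s.filter (fun b => b ∈ out a)).card + (s.filter (fun b => a ∈ out b)).card ≤ 2 * m := by
      refine Finset.exists_le_of_sum_le hs ?_
      have hswap : ∑ a ∈ s, (s.filter (fun b => a ∈ out b)).card
          = ∑ a ∈ s, (s.filter (fun b => b ∈ out a)).card :=
        (Finset.sum_card_bipartiteAbove_eq_sum_card_bipartiteBelow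
          (s := s) (t := s) (fun a b => a ∈ out b))
      rw [Finset.sum_add_distrib, hswap, ← two_mul, Finset.mul_sum]
      refine Finset.sum_le_sum fun a _ => Nat.mul_le_mul_left 2 ?_
      exact (Finset.card_le_card fun b hb => (Finset.mem_filter.1 hb).2).trans (hout a)
    obtain ⟨c, hc⟩ := ih (s.erase a) (Finset.erase_ssubset ha)
    set B : Finset α := s.filter (fun b => b ∈ out a) ∪ s.filter (fun b => a ∈ out b) with hB
    obtain ⟨x, hx⟩ : ∃ x, x ∉ B.image c := by
      by_contra! hall
      have h1 : Fintype.card (Fin (2 * m + 1)) ≤ (B.image c).card :=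
        Finset.card_le_card fun x _ => hall x
      have h2 : (B.image c).card ≤ B.card := Finset.card_image_le
      have h3 : B.card ≤ _ := Finset.card_union_le _ _
      rw [Fintype.card_fin] at h1
      omega
    have hxB : ∀ b ∈ B, c b ≠ x := fun b hb h => hx (Finset.mem_image.2 ⟨b, hb, h⟩)
    refine ⟨Function.update c a x, fun b hb d hd hbd hne => ?_⟩
    by_cases h1 : b = a
    · subst h1
      rw [Function.update_self, Function.update_of_ne hne]
      exact (hxB d (by simp [hB, hd, hbd])).symm
    · rw [Function.update_of_ne h1]
      by_cases h2 : d = a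
      · subst h2
        rw [Function.update_self]
        exact hxB b (by simp [hB, hb, hbd])
      · rw [Function.update_of_ne h2]
        exact hc b (by simp [hb, h1]) d (by simp [hd, h2]) hbd hne

/-! ### Edge sets that hit a pair once -/

section Hitting

variable {V : Type*}

/-- Exactly one edge of `T` meets the pair `u, v`, and it is not the edge `uv` itself. For an edge
`uv` of a graph and a colour class `T`, this says that the colour is unique for `uv`. -/
def HitsOnce (T : Set (Sym2 V)) (u v : V) : Prop :=
  ∃ f ∈ T, f ≠ s(u, v) ∧ (u ∈ f ∨ v ∈ f) ∧ ∀ f' ∈ T, (u ∈ f' ∨ v ∈ f') → f' = f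

theorem HitsOnce.symm {T : Set (Sym2 V)} {u v : V} (h : HitsOnce T u v) : HitsOnce T v u := by
  obtain ⟨f, hf, hne, hmem, huniq⟩ := h
  exact ⟨f, hf, by rwa [Sym2.eq_swap], hmem.symm, fun f' hf' h' => huniq f' hf' h'.symm⟩

theorem hitsOnce_of_mem {T : Set (Sym2 V)} {u v : V} {f : Sym2 V} (hf : f ∈ T) (hu : u ∈ f)
    (huniq : ∀ f' ∈ T, u ∈ f' → f' = f) (hv : ∀ f' ∈ T, v ∉ f') : HitsOnce T u v := by
  refine ⟨f, hf, ?_, Or.inl hu, ?_⟩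
  · rintro rfl
    exact hv _ hf (Sym2.mem_mk_right u v)
  · rintro f' hf' (h | h)
    · exact huniq f' hf' h
    · exact absurd h (hv f' hf')

/-- The edges of `M` are pairwise vertex-disjoint. -/
def IsMatchingSet (M : Set (Sym2 V)) : Prop :=
  ∀ e ∈ M, ∀ f ∈ M, ∀ v, v ∈ e → v ∈ f → e = f

/-- The vertices covered by a set of edges. -/
def covered (M : Set (Sym2 V)) : Set V :=
  {v | ∃ e ∈ M, v ∈ e}

theorem IsMatchingSet.hitsOnce {M : Set (Sym2 V)} (hM : IsMatchingSet M) {u v : V}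
    (hu : u ∈ covered M) (hv : v ∉ covered M) : HitsOnce M u v := by
  obtain ⟨f, hf, huf⟩ := hu
  exact hitsOnce_of_mem hf huf (fun f' hf' h => hM f' hf' f hf u h huf)
    fun f' hf' h => hv ⟨f', hf', h⟩

theorem exists_maximal_matchingSet [Finite V] (A : SimpleGraph V) (S : Set V) :
    ∃ M : Set (Sym2 V), M ⊆ A.edgeSet ∧ IsMatchingSet M ∧ covered M ⊆ S ∧
      ∀ u ∈ S, ∀ v ∈ S, A.Adj u v → u ∈ covered M ∨ v ∈ covered M := by
  obtain ⟨M, ⟨hA, hM, hS⟩, hmax⟩ := Set.Finite.exists_maximal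
    (s := {M : Set (Sym2 V) | M ⊆ A.edgeSet ∧ IsMatchingSet M ∧ covered M ⊆ S})
    (Set.toFinite _) ⟨∅, by simp [IsMatchingSet, covered]⟩
  refine ⟨M, hA, hM, hS, fun u hu v hv huv => ?_⟩
  by_contra! hcon
  have hnew : ∀ w ∈ s(u, v), w ∉ covered M := by
    intro w hw
    rcases Sym2.mem_iff.1 hw with rfl | rfl
    exacts [hcon.1, hcon.2]
  have hins : insert s(u, v) M ≤ M := by
    refine hmax ⟨?_, ?_, ?_⟩ (Set.subset_insert _ _)
    · exact Set.insert_subset huv hA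
    · rintro e (rfl | he) f (rfl | hf) w hwe hwf
      · rfl
      · exact absurd ⟨f, hf, hwf⟩ (hnew w hwe)
      · exact absurd ⟨e, he, hwe⟩ (hnew w hwf)
      · exact hM e he f hf w hwe hwf
    · rintro w ⟨e, rfl | he, hw⟩
      · rcases Sym2.mem_iff.1 hw with rfl | rfl
        exacts [hu, hv]
      · exact hS ⟨e, he, hw⟩
  exact hcon.1 ⟨_, hins (Set.mem_insert _ _), Sym2.mem_mk_left u v⟩

/-! ### Separating edges by matchings -/

/-- In a graph properly coloured with `2 ^ k + 1` colours, `k` disjoint matchings take care of all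
edges, up to the edges of the matchings themselves and the edges between the two sides of one
bipartition. -/
theorem exists_separating_matchings [Finite V] (k : ℕ) (A : SimpleGraph V) (c : V → ℕ)
    (hlt : ∀ v, c v < 2 ^ k + 1) (hc : ∀ u v, A.Adj u v → c u ≠ c v) :
    ∃ (M : Fin k → Set (Sym2 V)) (g : V → Bool),
      (∀ i, M i ⊆ A.edgeSet) ∧ (∀ i, IsMatchingSet (M i)) ∧
      (∀ i j e, e ∈ M i → e ∈ M j → i = j) ∧
      ∀ u v, A.Adj u v → (∃ i, s(u, v) ∈ M i) ∨ (∃ i, HitsOnce (M i) u v) ∨ g u ≠ g v := by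
  classical
  induction k generalizing A c with
  | zero =>
    refine ⟨fun i => i.elim0, fun v => decide (c v = 0), fun i => i.elim0, fun i => i.elim0,
      fun i => i.elim0, fun u v huv => Or.inr (Or.inr fun h => hc u v huv ?_)⟩
    have hu := hlt u
    have hv := hlt v
    have h' : c u = 0 ↔ c v = 0 := by simpa using h
    omega
  | succ k ih =>
    obtain ⟨N, hNA, hN, hNS, hmax⟩ := exists_maximal_matchingSet A {v | c v < 2 ^ k + 1}
    -- The edges that `N` neither contains nor hits once.
    let A' : SimpleGraph V :=
      { Adj := fun u v => A.Adj u v ∧ s(u, v) ∉ N ∧ (u ∈ covered N ↔ v ∈ covered N)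
        symm := ⟨fun u v h => ⟨h.1.symm, by rw [Sym2.eq_swap]; exact h.2.1, h.2.2.symm⟩⟩
        loopless := ⟨fun u h => h.1.ne rfl⟩ }
    -- The vertices of the first `2 ^ k + 1` classes left uncovered by `N` are independent, so they
    -- form a single class next to the other `2 ^ k` classes.
    obtain ⟨M, g, hMA, hM, hdisj, hsat⟩ := ih A'
      (fun v => if v ∈ covered N then c v else if c v < 2 ^ k + 1 then 2 ^ k
        else c v - (2 ^ k + 1))
      (by
        intro v
        have := hlt v
        rw [pow_succ] at this
        split_ifs with h1 h2
        · exact hNS h1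
        · omega
        · omega)
      (by
        rintro u v ⟨huv, -, hiff⟩
        have hu := hlt u
        have hv := hlt v
        rw [pow_succ] at hu hv
        have hne := hc u v huv
        by_cases hcu : u ∈ covered N
        · simp only [hcu, hiff.1 hcu, if_true]
          exact hne
        · have hcv : v ∉ covered N := fun h => hcu (hiff.2 h)
          have hnot : ¬ (c u < 2 ^ k + 1 ∧ c v < 2 ^ k + 1) := fun h =>
            (hmax u h.1 v h.2 huv).elim hcu hcv
          simp only [hcu, hcv, if_false]
          split_ifs <;> omega)
    refine ⟨Fin.cons N M, g, ?_, ?_, ?_, ?_⟩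
    · refine Fin.cases hNA fun i e he => ?_
      have := hMA i he
      induction e with
      | h u v => exact this.1
    · exact Fin.cases hN hM
    · have hNM : ∀ i e, e ∈ N → e ∉ M i := by
        intro i e he he'
        have := hMA i he'
        induction e with
        | h u v => exact this.2.1 he
      intro i j e hi hj
      induction i using Fin.cases with
      | zero =>
        induction j using Fin.cases with
        | zero => rfl
        | succ j => exact absurd hj (hNM j e hi)
      | succ i =>
        induction j using Fin.cases with
        | zero => exact absurd hi (hNM i e hj)
        | succ j => exact congrArg Fin.succ (hdisj i j e hi hj)
    · intro u v huv
      by_cases huvN : s(u, v) ∈ N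
      · exact Or.inl ⟨0, huvN⟩
      by_cases hiff : u ∈ covered N ↔ v ∈ covered N
      · rcases hsat u v ⟨huv, huvN, hiff⟩ with ⟨i, hi⟩ | ⟨i, hi⟩ | h
        · exact Or.inl ⟨i.succ, hi⟩
        · exact Or.inr (Or.inl ⟨i.succ, hi⟩)
        · exact Or.inr (Or.inr h)
      · refine Or.inr (Or.inl ⟨0, ?_⟩)
        by_cases hu : u ∈ covered N
        · exact hN.hitsOnce hu fun hv => hiff (iff_of_true hu hv)
        · exact (hN.hitsOnce (by_contra fun hv => hiff (iff_of_false hu hv)) hu).symm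

/-! ### Cuts -/

/-- If the graph `W` has degree at least two on `S`, then four sets of edges of `W` suffice to hit
every pair `u ∈ S`, `v ∉ S` once. A maximal matching of `W[S]` serves the `u` it covers; the other
`u` are independent and have a minimal dominating set `J`. One class joins each `j ∈ J` to a private
neighbour `p j`, one joins each `u` to some element of `J`, and one leads from each `p j` to a vertex
outside `J`. Which class serves `u, v` depends on whether `v ∈ J` and whether `u` is a `p j`. -/
theorem exists_edge_classes_of_cut [Finite V] (W : SimpleGraph V) (S : Set V)
    (hS : ∀ u ∈ S, ∃ w₁ w₂, w₁ ≠ w₂ ∧ W.Adj u w₁ ∧ W.Adj u w₂) :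
    ∃ T : Fin 4 → Set (Sym2 V), (∀ a, T a ⊆ W.edgeSet) ∧
      ∀ u ∈ S, ∀ v ∉ S, ∃ a, HitsOnce (T a) u v := by
  classical
  obtain ⟨N, hNW, hN, hNS, hmax⟩ := exists_maximal_matchingSet W S
  -- `I` is independent in `W`; `J` is a minimal set of vertices dominating `I` from outside.
  set I : Set V := S \ covered N with hI
  have hind : ∀ u ∈ I, ∀ w ∈ I, ¬ W.Adj u w := fun u hu w hw h =>
    (hmax u hu.1 w hw.1 h).elim hu.2 hw.2
  obtain ⟨J, ⟨hJI, hdom⟩, hJmin⟩ := Set.Finite.exists_minimal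
    (s := {J : Set V | J ⊆ Iᶜ ∧ ∀ u ∈ I, ∃ w ∈ J, W.Adj u w})
    (Set.toFinite _) ⟨Iᶜ, subset_rfl, fun u hu => by
      obtain ⟨w, -, -, hw, -⟩ := hS u hu.1
      exact ⟨w, fun hwI => hind u hu w hwI hw, hw⟩⟩
  have hpriv : ∀ j ∈ J, ∃ u ∈ I, W.Adj u j ∧ ∀ w ∈ J, W.Adj u w → w = j := by
    intro j hj
    by_contra! hcon
    have : J ≤ J \ {j} := by
      refine hJmin ⟨Set.sdiff_subset.trans hJI, fun u hu => ?_⟩ Set.sdiff_subset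
      obtain ⟨w, hw, huw⟩ := hdom u hu
      by_cases hwj : w = j
      · subst hwj
        obtain ⟨w', hw', huw', hne⟩ := hcon u hu huw
        exact ⟨w', ⟨hw', hne⟩, huw'⟩
      · exact ⟨w, ⟨hw, hwj⟩, huw⟩
    exact (this hj).2 rfl
  choose! p hpI hpW hpJ using hpriv
  choose! b hbJ hbW using hdom
  -- A private neighbour of `j ∈ J` has a second neighbour, which lies outside `I` and `J`.
  have hthird : ∀ j ∈ J, ∃ w, w ∉ I ∧ w ∉ J ∧ W.Adj (p j) w := by
    intro j hj
    obtain ⟨w, hne, hw⟩ : ∃ w, w ≠ j ∧ W.Adj (p j) w := by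
      obtain ⟨w₁, w₂, hne, h₁, h₂⟩ := hS (p j) (hpI j hj).1
      by_cases h : w₁ = j
      · exact ⟨w₂, fun h' => hne (h.trans h'.symm), h₂⟩
      · exact ⟨w₁, h, h₁⟩
    exact ⟨w, fun hwI => hind _ (hpI j hj) w hwI hw, fun hwJ => hne (hpJ j hj w hwJ hw), hw⟩
  choose! q hqI hqJ hqW using hthird
  have hpinj : ∀ j ∈ J, ∀ j' ∈ J, p j = p j' → j = j' := fun j hj j' hj' h =>
    hpJ j' hj' j hj (h ▸ hpW j hj)
  let T₁ : Set (Sym2 V) := {f | ∃ j ∈ J, f = s(p j, j)}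
  let T₂ : Set (Sym2 V) := {f | ∃ u ∈ I, f = s(u, b u)}
  let T₃ : Set (Sym2 V) := {f | ∃ j ∈ J, f = s(p j, q j)}
  refine ⟨![N, T₁, T₂, T₃], ?_, fun u hu v hv => ?_⟩
  · intro a
    fin_cases a
    · exact hNW
    · rintro _ ⟨j, hj, rfl⟩
      exact hpW j hj
    · rintro _ ⟨u, hu, rfl⟩
      exact hbW u hu
    · rintro _ ⟨j, hj, rfl⟩
      exact hqW j hj
  have hvI : v ∉ I := fun h => hv h.1
  by_cases huN : u ∈ covered N
  · exact ⟨0, hN.hitsOnce huN fun h => hv (hNS h)⟩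
  have huI : u ∈ I := ⟨hu, huN⟩
  by_cases hvJ : v ∈ J
  · by_cases hup : ∃ j ∈ J, u = p j
    · obtain ⟨j, hj, rfl⟩ := hup
      refine ⟨3, hitsOnce_of_mem (f := s(p j, q j)) ⟨j, hj, rfl⟩ (Sym2.mem_mk_left _ _) ?_ ?_⟩
      · rintro _ ⟨j', hj', rfl⟩ h
        rcases Sym2.mem_iff.1 h with h | h
        · rw [hpinj j hj j' hj' h]
        · exact absurd (h ▸ huI) (hqI j' hj')
      · rintro _ ⟨j', hj', rfl⟩ h
        rcases Sym2.mem_iff.1 h with h | h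
        · exact hvI (h ▸ hpI j' hj')
        · exact hqJ j' hj' (h ▸ hvJ)
    · refine ⟨1, HitsOnce.symm (hitsOnce_of_mem (f := s(p v, v)) ⟨v, hvJ, rfl⟩
        (Sym2.mem_mk_right _ _) ?_ ?_)⟩
      · rintro _ ⟨j', hj', rfl⟩ h
        rcases Sym2.mem_iff.1 h with h | h
        · exact absurd (h ▸ hpI j' hj') hvI
        · rw [h]
      · rintro _ ⟨j', hj', rfl⟩ h
        rcases Sym2.mem_iff.1 h with h | h
        · exact hup ⟨j', hj', h⟩
        · exact hJI (h ▸ hj') huI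
  · refine ⟨2, hitsOnce_of_mem (f := s(u, b u)) ⟨u, huI, rfl⟩ (Sym2.mem_mk_left _ _) ?_ ?_⟩
    · rintro _ ⟨u', hu', rfl⟩ h
      rcases Sym2.mem_iff.1 h with h | h
      · rw [h]
      · exact absurd huI (hJI (h ▸ hbJ u' hu'))
    · rintro _ ⟨u', hu', rfl⟩ h
      rcases Sym2.mem_iff.1 h with h | h
      · exact hvI (h ▸ hu')
      · exact hvJ (h ▸ hbJ u' hu')

end Hitting


/-! ### Reserving edges at vertices of large degree -/

section Degrees

variable {V : Type*}

theorem card_filter_mem_sym2_le_two [DecidableEq V] (A : Finset V) (e : Sym2 V) :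
    (A.filter (fun v => v ∈ e)).card ≤ 2 := by
  induction e with
  | h a b =>
    refine (Finset.card_le_card (t := {a, b}) fun v hv => ?_).trans Finset.card_le_two
    simpa using (Finset.mem_filter.1 hv).2

variable [Fintype V]

/-- By Hall's theorem, vertices of degree at least `2 * r` can reserve `r` of their edges each,
without conflicts. -/
theorem exists_injective_incident_edges (G : SimpleGraph V) [DecidableRel G.Adj]
    {κ : Type*} [Fintype κ] (R : Set V) (hR : ∀ v ∈ R, 2 * Fintype.card κ ≤ G.degree v) :
    ∃ o : R × κ → Sym2 V, Function.Injective o ∧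
      ∀ x, o x ∈ G.edgeSet ∧ (x.1 : V) ∈ o x := by
  classical
  obtain ⟨o, ho, hmem⟩ := (Finset.all_card_le_biUnion_card_iff_exists_injective
    (fun x : R × κ => G.incidenceFinset (x.1 : V))).1 (by
      intro P
      set A : Finset V := P.image (fun x => (x.1 : V)) with hA
      set U : Finset (Sym2 V) := P.biUnion (fun x => G.incidenceFinset (x.1 : V)) with hU
      have hP : P.card ≤ A.card * Fintype.card κ := by
        have hinj : P.card ≤ (A ×ˢ (Finset.univ : Finset κ)).card := by
          refine Finset.card_le_card_of_injOn (fun x => ((x.1 : V), x.2)) ?_ ?_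
          · intro x hx
            simpa [hA] using ⟨x.2, hx⟩
          · rintro ⟨⟨v, hv⟩, i⟩ - ⟨⟨w, hw⟩, j⟩ - h
            simpa using h
        rwa [Finset.card_product, Finset.card_univ] at hinj
      have hcount : ∑ v ∈ A, (U.filter (fun e => v ∈ e)).card ≤ U.card * 2 := by
        refine (Finset.sum_card_bipartiteAbove_eq_sum_card_bipartiteBelow
          (s := A) (t := U) (fun v e => v ∈ e)).trans_le ?_
        exact Finset.sum_le_card_nsmul _ _ _ fun e _ => card_filter_mem_sym2_le_two A e
      have hdeg : A.card * (2 * Fintype.card κ) ≤ ∑ v ∈ A, (U.filter (fun e => v ∈ e)).card := by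
        refine Finset.card_nsmul_le_sum _ _ _ fun v hv => ?_
        obtain ⟨x, hx, rfl⟩ := Finset.mem_image.1 hv
        refine (hR x.1 x.1.2).trans ?_
        rw [← G.card_incidenceFinset_eq_degree]
        refine Finset.card_le_card fun e he => Finset.mem_filter.2 ⟨?_, ?_⟩
        · exact Finset.mem_biUnion.2 ⟨x, hx, he⟩
        · exact ((G.mem_incidenceFinset _ _).1 he).2
      nlinarith)
  exact ⟨o, ho, fun x => (G.mem_incidenceFinset _ _).1 (hmem x)⟩

/-! ### Edges between vertices of small degree -/

theorem card_edges_meeting_le (G : SimpleGraph V) [DecidableRel G.Adj] (D : ℕ) (X : Finset V)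
    (hX : X.card ≤ 2) (hdeg : ∀ v ∈ X, G.degree v ≤ D) (F : Finset G.edgeSet)
    (hF : ∀ e ∈ F, ∃ v ∈ X, v ∈ (e : Sym2 V)) : F.card ≤ 2 * D := by
  classical
  have h1 : F.card ≤ (X.biUnion fun v => G.incidenceFinset v).card := by
    refine Finset.card_le_card_of_injOn Subtype.val ?_ Subtype.val_injective.injOn
    intro e he
    obtain ⟨v, hv, hve⟩ := hF e he
    exact Finset.mem_biUnion.2 ⟨v, hv, (G.mem_incidenceFinset _ _).2 ⟨e.2, hve⟩⟩
  have h2 : (X.biUnion fun v => G.incidenceFinset v).card ≤ X.card * D :=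
    Finset.card_biUnion_le_card_mul _ _ _ fun v hv => by
      rw [G.card_incidenceFinset_eq_degree]
      exact hdeg v hv
  exact h1.trans (h2.trans (Nat.mul_le_mul_right D hX))

/-- Boundedly many colours satisfy all edges inside a set `L` of vertices of bounded degree. The
witnesses of these edges may lead out of `L`. -/
theorem exists_colouring_of_degree_le (G : SimpleGraph V) [DecidableRel G.Adj] (D : ℕ) (L : Set V)
    (hL : ∀ v ∈ L, G.degree v ≤ D) :
    ∃ z : G.edgeSet → Fin (2 * (2 * D * (2 * D)) + 1),
      ∀ e : G.edgeSet, (∀ v ∈ (e : Sym2 V), v ∈ L) → (openNbhd e).Nonempty →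
        ∃ e' ∈ openNbhd e, ∀ e'' ∈ closedNbhd e, e'' ≠ e' → z e'' ≠ z e' := by
  classical
  have hpick : ∀ e : G.edgeSet, ∃ e', (openNbhd e).Nonempty → e' ∈ openNbhd e := fun e => by
    by_cases h : (openNbhd e).Nonempty
    · exact ⟨h.some, fun _ => h.some_mem⟩
    · exact ⟨e, fun h' => absurd h' h⟩
  choose w hw using hpick
  -- The witness `w e` has to be separated from all edges that meet `e`.
  let inner (f : G.edgeSet) : Finset G.edgeSet := Finset.univ.filter fun e =>
    (∀ v ∈ (e : Sym2 V), v ∈ L) ∧ (openNbhd e).Nonempty ∧ w e = f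
  let out (f : G.edgeSet) : Finset G.edgeSet :=
    (inner f).biUnion fun e => Finset.univ.filter fun e'' => e'' ∈ closedNbhd e
  have hout : ∀ f, (out f).card ≤ 2 * D * (2 * D) := by
    intro f
    have h1 : (inner f).card ≤ 2 * D := by
      refine card_edges_meeting_le G D
        ((Finset.univ.filter (fun v => v ∈ (f : Sym2 V))).filter (fun v => v ∈ L))
        ((Finset.card_filter_le _ _).trans (card_filter_mem_sym2_le_two _ _))
        (fun v hv => hL v (Finset.mem_filter.1 hv).2) _ fun e he => ?_
      obtain ⟨heL, hne, rfl⟩ := (Finset.mem_filter.1 he).2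
      obtain ⟨v, hve, hvw⟩ := (hw e hne).1
      exact ⟨v, by simp [hvw, heL v hve], hve⟩
    refine (Finset.card_biUnion_le_card_mul _ _ (2 * D) fun e he => ?_).trans
      (Nat.mul_le_mul_right _ h1)
    refine card_edges_meeting_le G D (Finset.univ.filter (fun v => v ∈ (e : Sym2 V)))
      (card_filter_mem_sym2_le_two _ _)
      (fun v hv => hL v ((Finset.mem_filter.1 he).2.1 v (Finset.mem_filter.1 hv).2)) _
      fun e'' he'' => ?_
    obtain ⟨v, hve, hve''⟩ := (Finset.mem_filter.1 he'').2
    exact ⟨v, by simp [hve], hve''⟩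
  obtain ⟨z, hz⟩ := exists_colouring_of_card_out_le out _ hout
  refine ⟨z, fun e heL hne => ⟨w e, hw e hne, fun e'' he'' hne'' => ?_⟩⟩
  refine (hz (w e) e'' (Finset.mem_biUnion.2 ⟨e, ?_, ?_⟩) hne'').symm
  · simpa [inner, hne] using heL
  · simpa using he''

end Degrees


/-! ### The colouring -/

section Assembly

variable {V : Type*}

theorem isSatisfied_of_hitsOnce {G : SimpleGraph V} {C : Type*} {c : G.edgeSet → C}
    {e : G.edgeSet} {u v : V} (he : (e : Sym2 V) = s(u, v)) {T : Set (Sym2 V)}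
    (hT : HitsOnce T u v) (hTG : T ⊆ G.edgeSet)
    (hsat : ∀ f f' : G.edgeSet, (f : Sym2 V) ∈ T → c f' = c f → (f' : Sym2 V) ∈ T) :
    IsSatisfied c e := by
  obtain ⟨f, hf, hne, hmem, huniq⟩ := hT
  refine ⟨c ⟨f, hTG hf⟩, ⟨f, hTG hf⟩, ⟨?_, ?_⟩, rfl, ?_⟩
  · rcases hmem with h | h
    · exact ⟨u, by rw [he]; exact Sym2.mem_mk_left u v, h⟩
    · exact ⟨v, by rw [he]; exact Sym2.mem_mk_right u v, h⟩
  · rintro rfl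
    exact hne he
  · rintro f' ⟨w, hwe, hwf'⟩ hne' hcol
    refine hne' (Subtype.ext (huniq f' (hsat ⟨f, hTG hf⟩ f' hf hcol) ?_))
    rw [he] at hwe
    rcases Sym2.mem_iff.1 hwe with rfl | rfl
    exacts [Or.inl hwf', Or.inr hwf']

theorem card_filter_exists_le [Fintype V] {ι : Type*} [Fintype ι] (P : ι → V → Prop)
    [DecidablePred fun w => ∃ i, P i w] (hP : ∀ i w w', P i w → P i w' → w = w') :
    (Finset.univ.filter fun w => ∃ i, P i w).card ≤ Fintype.card ι := by
  classical
  have hsub : (Finset.univ.filter fun w => ∃ i, P i w) ⊆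
      (Finset.univ : Finset ι).biUnion fun i => Finset.univ.filter fun w => P i w := fun w hw => by
    simpa using hw
  refine (Finset.card_le_card hsub).trans
    ((Finset.card_biUnion_le_card_mul _ _ 1 fun i _ => Finset.card_le_one.2 ?_).trans_eq ?_)
  · intro w hw w' hw'
    exact hP i w w' (Finset.mem_filter.1 hw).2 (Finset.mem_filter.1 hw').2
  · rw [mul_one, Finset.card_univ]

theorem exists_testBit_ne {x y Q : ℕ} (hx : x < 2 ^ Q) (hy : y < 2 ^ Q) (hne : x ≠ y) :
    ∃ i : Fin Q, x.testBit i ≠ y.testBit i := by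
  by_contra! h
  refine hne (Nat.eq_of_testBit_eq fun i => ?_)
  by_cases hi : i < Q
  · exact h ⟨i, hi⟩
  · have hle : 2 ^ Q ≤ 2 ^ i := Nat.pow_le_pow_right two_pos (not_lt.1 hi)
    rw [Nat.testBit_lt_two_pow (hx.trans_le hle), Nat.testBit_lt_two_pow (hy.trans_le hle)]

/-- `k` colours for the separating matchings and `O(Q ^ 3)` colours for everything else suffice,
where `Q + 2` is the number of cuts that remain to be treated after the matchings are chosen. -/
theorem exists_isConflictFree [Fintype V] (G : SimpleGraph V) [DecidableRel G.Adj] (k Q : ℕ)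
    (hk : 2 * G.maxDegree ≤ 2 ^ k) (hQ : 2 * (k + 2 * (Q + 2)) + 1 ≤ 2 ^ Q) :
    ∃ c : G.edgeSet → Fin k ⊕ (Option (Option (Option (Fin Q)) × (Fin 4 → Bool)) ×
        Fin (2 * (2 * (4 * (Q + 2)) * (2 * (4 * (Q + 2)))) + 1)),
      IsConflictFree c := by
  classical
  set R : Set V := {v | 4 * (Q + 2) ≤ G.degree v} with hRdef
  obtain ⟨o, ho, homem⟩ := exists_injective_incident_edges G
    (κ := Option (Option (Fin Q)) × Bool) R (fun v hv => by
      have : 4 * (Q + 2) ≤ G.degree v := hv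
      simp only [Fintype.card_prod, Fintype.card_option, Fintype.card_fin, Fintype.card_bool]
      omega)
  obtain ⟨z, hz⟩ := exists_colouring_of_degree_le G (4 * (Q + 2)) Rᶜ
    (fun v (hv : ¬ 4 * (Q + 2) ≤ G.degree v) => (not_le.1 hv).le)
  obtain ⟨c₀, hc₀⟩ := exists_colouring_of_card_out_le (fun v => G.neighborFinset v) G.maxDegree
    (fun v => by rw [G.card_neighborFinset_eq_degree]; exact G.degree_le_maxDegree v)
  -- The matchings use only edges between vertices of large degree that are not reserved.
  let A : SimpleGraph V :=
    { Adj := fun u v => G.Adj u v ∧ (u ∈ R ∧ v ∈ R) ∧ s(u, v) ∉ Set.range o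
      symm := ⟨fun u v h => ⟨h.1.symm, h.2.1.symm, by rw [Sym2.eq_swap]; exact h.2.2⟩⟩
      loopless := ⟨fun u h => h.1.ne rfl⟩ }
  obtain ⟨M, g, hMA, hM, hMdisj, hMsat⟩ := exists_separating_matchings k A
    (fun v => (c₀ v : ℕ)) (fun v => (c₀ v).isLt.trans_le (by omega)) (fun u v huv h =>
      hc₀ u v ((G.mem_neighborFinset u v).2 huv.1) huv.1.ne' (Fin.ext h))
  have hMG : ∀ i, ∀ f ∈ M i, f ∈ G.edgeSet ∧ (∀ v ∈ f, v ∈ R) ∧ f ∉ Set.range o := by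
    intro i f hf
    have := hMA i hf
    induction f with
    | h u v =>
      refine ⟨this.1, fun w hw => ?_, this.2.2⟩
      rcases Sym2.mem_iff.1 hw with rfl | rfl
      exacts [this.2.1.1, this.2.1.2]
  -- The edges of the matchings and the reserved edges form a graph of small chromatic number.
  obtain ⟨h, hh⟩ := exists_colouring_of_card_out_le
    (fun v => (Finset.univ.filter fun w => ∃ i, s(v, w) ∈ M i) ∪
      Finset.univ.filter fun w => ∃ x, ∃ hv : v ∈ R, o (⟨v, hv⟩, x) = s(v, w))
    (k + 2 * (Q + 2)) (fun v => by
      refine (Finset.card_union_le _ _).trans (Nat.add_le_add ?_ ?_)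
      · refine (card_filter_exists_le (fun i w => s(v, w) ∈ M i) ?_).trans_eq (Fintype.card_fin k)
        intro i w w' hw hw'
        exact Sym2.congr_right.1
          (hM i _ hw _ hw' v (Sym2.mem_mk_left _ _) (Sym2.mem_mk_left _ _))
      · refine (card_filter_exists_le
          (fun x w => ∃ hv : v ∈ R, o (⟨v, hv⟩, x) = s(v, w)) ?_).trans_eq ?_
        · rintro x w w' ⟨_, hw⟩ ⟨_, hw'⟩
          exact Sym2.congr_right.1 (hw.symm.trans hw')
        · simp only [Fintype.card_prod, Fintype.card_option, Fintype.card_fin, Fintype.card_bool]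
          ring)
  let S : Option (Option (Fin Q)) → Set V
    | none => R
    | some none => {v | v ∈ R ∧ g v = true}
    | some (some i) => {v | v ∈ R ∧ (h v : ℕ).testBit i = true}
  have hSR : ∀ l, S l ⊆ R := by
    rintro (_ | _ | i) v hv
    exacts [hv, hv.1, hv.1]
  let W (l : Option (Option (Fin Q))) : Set (Sym2 V) :=
    Set.range fun y : R × Bool => o (y.1, (l, y.2))
  have hWG : ∀ l, W l ⊆ G.edgeSet := by
    rintro l _ ⟨y, rfl⟩
    exact (homem _).1
  have hWdisj : ∀ l l' f, f ∈ W l → f ∈ W l' → l = l' := by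
    rintro l l' _ ⟨y, rfl⟩ ⟨y', hy'⟩
    exact (congrArg (fun x => x.2.1) (ho hy')).symm
  have hcut : ∀ l, ∃ T : Fin 4 → Set (Sym2 V), (∀ a, T a ⊆ W l) ∧
      ∀ u ∈ S l, ∀ v ∉ S l, ∃ a, HitsOnce (T a) u v := by
    intro l
    obtain ⟨T, hT, hhit⟩ := exists_edge_classes_of_cut (SimpleGraph.fromEdgeSet (W l)) (S l) (by
      intro u hu
      have hadj : ∀ b : Bool, ∃ w, o (⟨u, hSR l hu⟩, (l, b)) = s(u, w) ∧
          (SimpleGraph.fromEdgeSet (W l)).Adj u w := by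
        intro b
        obtain ⟨hG, w, hw⟩ := homem (⟨u, hSR l hu⟩, (l, b))
        refine ⟨w, hw, (SimpleGraph.fromEdgeSet_adj _).2 ⟨⟨(⟨u, hSR l hu⟩, b), hw⟩, ?_⟩⟩
        rw [hw] at hG
        exact SimpleGraph.Adj.ne hG
      obtain ⟨w₁, h₁, hw₁⟩ := hadj false
      obtain ⟨w₂, h₂, hw₂⟩ := hadj true
      refine ⟨w₁, w₂, ?_, hw₁, hw₂⟩
      rintro rfl
      simpa using ho (h₁.trans h₂.symm))
    refine ⟨T, fun a f hf => ?_, hhit⟩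
    have := hT a hf
    rw [SimpleGraph.edgeSet_fromEdgeSet] at this
    exact this.1
  choose T hTW hhit using hcut
  -- The classes `T l a` for fixed `l` may overlap; an edge is coloured by the set of classes that
  -- contain it, which refines every one of them.
  let pal (f : Sym2 V) : Option (Option (Option (Fin Q)) × (Fin 4 → Bool)) :=
    if hf : ∃ l, f ∈ W l then some (hf.choose, fun a => decide (f ∈ T hf.choose a)) else none
  have hpal : ∀ l f, f ∈ W l → pal f = some (l, fun a => decide (f ∈ T l a)) := by
    intro l f hf
    have hex : ∃ l, f ∈ W l := ⟨l, hf⟩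
    have hl : hex.choose = l := hWdisj _ _ f hex.choose_spec hf
    simp only [pal, dif_pos hex, hl]
  have hpal' : ∀ l a f f', f ∈ T l a → pal f' = pal f → f' ∈ T l a := by
    intro l a f f' hf heq
    rw [hpal l f (hTW l a hf)] at heq
    by_cases hex : ∃ l, f' ∈ W l
    · obtain ⟨l', hl'⟩ := hex
      rw [hpal l' f' hl'] at heq
      obtain ⟨rfl, h2⟩ := Prod.mk.inj (Option.some_injective _ heq)
      simpa [hf] using congrFun h2 a
    · simp [pal, hex] at heq
  let c (f : G.edgeSet) : Fin k ⊕ (Option (Option (Option (Fin Q)) × (Fin 4 → Bool)) ×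
        Fin (2 * (2 * (4 * (Q + 2)) * (2 * (4 * (Q + 2)))) + 1)) :=
    if hf : ∃ i, (f : Sym2 V) ∈ M i then Sum.inl hf.choose else Sum.inr (pal f, z f)
  have hcM : ∀ i (f : G.edgeSet), (f : Sym2 V) ∈ M i → c f = Sum.inl i := by
    intro i f hf
    have hex : ∃ i, (f : Sym2 V) ∈ M i := ⟨i, hf⟩
    have hi : hex.choose = i := hMdisj _ _ _ hex.choose_spec hf
    simp only [c, dif_pos hex, hi]
  have hcN : ∀ f : G.edgeSet, (¬ ∃ i, (f : Sym2 V) ∈ M i) → c f = Sum.inr (pal f, z f) :=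
    fun f hf => dif_neg hf
  have hsatM : ∀ i u v, ∀ e : G.edgeSet, (e : Sym2 V) = s(u, v) → HitsOnce (M i) u v →
      IsSatisfied c e := by
    intro i u v e he hhits
    refine isSatisfied_of_hitsOnce he hhits (fun f hf => (hMG i f hf).1) fun f f' hf heq => ?_
    rw [hcM i f hf] at heq
    by_cases hex : ∃ j, (f' : Sym2 V) ∈ M j
    · obtain ⟨j, hj⟩ := hex
      rw [hcM j f' hj] at heq
      exact Sum.inl_injective heq ▸ hj
    · simp [hcN f' hex] at heq
  have hsatT : ∀ l u v, ∀ e : G.edgeSet, (e : Sym2 V) = s(u, v) → u ∈ S l → v ∉ S l →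
      IsSatisfied c e := by
    intro l u v e he hu hv
    obtain ⟨a, ha⟩ := hhit l u hu v hv
    refine isSatisfied_of_hitsOnce he ha (fun f hf => hWG l (hTW l a hf)) fun f f' hf heq => ?_
    have hfM : ¬ ∃ i, (f : Sym2 V) ∈ M i := by
      rintro ⟨i, hi⟩
      obtain ⟨y, hy⟩ := hTW l a hf
      exact (hMG i f hi).2.2 ⟨_, hy⟩
    rw [hcN f hfM] at heq
    by_cases hex : ∃ j, (f' : Sym2 V) ∈ M j
    · obtain ⟨j, hj⟩ := hex
      simp [hcM j f' hj] at heq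
    · rw [hcN f' hex] at heq
      exact hpal' l a f f' hf (congrArg Prod.fst (Sum.inr_injective heq))
  have hsatT' : ∀ l u v, ∀ e : G.edgeSet, (e : Sym2 V) = s(u, v) → ¬ (u ∈ S l ↔ v ∈ S l) →
      IsSatisfied c e := by
    intro l u v e he hiff
    by_cases hu : u ∈ S l
    · exact hsatT l u v e he hu fun hv => hiff (iff_of_true hu hv)
    · exact hsatT l v u e (he.trans Sym2.eq_swap)
        (by_contra fun hv => hiff (iff_of_false hu hv)) hu
  refine ⟨c, fun e hne => ?_⟩
  obtain ⟨u, v, he⟩ : ∃ u v, (e : Sym2 V) = s(u, v) := by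
    induction h' : (e : Sym2 V) with
    | h u v => exact ⟨u, v, rfl⟩
  have hadj : G.Adj u v := by
    have := e.2
    rwa [he] at this
  by_cases hiff : u ∈ R ↔ v ∈ R
  swap
  · exact hsatT' none u v e he hiff
  by_cases hu : u ∈ R
  swap
  · have hL : ∀ w ∈ (e : Sym2 V), w ∈ Rᶜ := by
      intro w hw
      rw [he] at hw
      rcases Sym2.mem_iff.1 hw with rfl | rfl
      exacts [hu, fun h => hu (hiff.2 h)]
    obtain ⟨e', he', huniq⟩ := hz e hL hne
    have hinr : ∀ f ∈ closedNbhd e, c f = Sum.inr (pal f, z f) := by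
      rintro f ⟨w, hwe, hwf⟩
      refine hcN f ?_
      rintro ⟨i, hi⟩
      exact hL w hwe ((hMG i f hi).2.1 w hwf)
    refine ⟨c e', e', he', rfl, fun e'' he'' hne'' heq => huniq e'' he'' hne'' ?_⟩
    rw [hinr e'' he'', hinr e' he'.1] at heq
    exact congrArg Prod.snd (Sum.inr_injective heq)
  have hv : v ∈ R := hiff.1 hu
  have hbits : h u ≠ h v → IsSatisfied c e := by
    intro hne'
    obtain ⟨i, hi⟩ := exists_testBit_ne ((h u).isLt.trans_le hQ) ((h v).isLt.trans_le hQ)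
      (fun h' => hne' (Fin.ext h'))
    refine hsatT' (some (some i)) u v e he fun hiff' => hi (Bool.eq_iff_iff.2 ?_)
    simpa [S, hu, hv] using hiff'
  by_cases hres : s(u, v) ∈ Set.range o
  · obtain ⟨⟨w, x⟩, hwx⟩ := hres
    have hw : (w : V) ∈ s(u, v) := hwx ▸ (homem (w, x)).2
    obtain ⟨w, hwR⟩ := w
    rcases Sym2.mem_iff.1 hw with rfl | rfl
    · refine hbits (hh w v ?_ hadj.ne')
      exact Finset.mem_union_right _ (Finset.mem_filter.2 ⟨Finset.mem_univ _, x, hwR, hwx⟩)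
    · refine hbits (hh w u ?_ hadj.ne).symm
      exact Finset.mem_union_right _
        (Finset.mem_filter.2 ⟨Finset.mem_univ _, x, hwR, hwx.trans Sym2.eq_swap⟩)
  rcases hMsat u v ⟨hadj, ⟨hu, hv⟩, hres⟩ with ⟨i, hi⟩ | ⟨i, hi⟩ | hg
  · exact hbits (hh u v (Finset.mem_union_left _
      (Finset.mem_filter.2 ⟨Finset.mem_univ _, i, hi⟩)) hadj.ne')
  · exact hsatM i u v e he hi
  · refine hsatT' (some none) u v e he fun hiff' => hg (Bool.eq_iff_iff.2 ?_)
    simpa [S, hu, hv] using hiff'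

theorem chromaticIndex_le [Fintype V] (G : SimpleGraph V) [DecidableRel G.Adj] (k Q : ℕ)
    (hk : 2 * G.maxDegree ≤ 2 ^ k) (hQ : 2 * (k + 2 * (Q + 2)) + 1 ≤ 2 ^ Q) :
    chromaticIndex G ≤ k + (16 * (Q + 2) + 1) * (128 * (Q + 2) ^ 2 + 1) := by
  obtain ⟨c, hc⟩ := exists_isConflictFree G k Q hk hQ
  refine Nat.sInf_le ?_
  obtain ⟨φ⟩ : Nonempty (Fin k ⊕ (Option (Option (Option (Fin Q)) × (Fin 4 → Bool)) ×
        Fin (2 * (2 * (4 * (Q + 2)) * (2 * (4 * (Q + 2)))) + 1)) ≃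
      Fin (k + (16 * (Q + 2) + 1) * (128 * (Q + 2) ^ 2 + 1))) := by
    refine ⟨Fintype.equivFinOfCardEq ?_⟩
    simp only [Fintype.card_sum, Fintype.card_prod, Fintype.card_option, Fintype.card_fin,
      Fintype.card_pi, Fintype.card_bool, Finset.prod_const, Finset.card_univ]
    ring
  refine ⟨φ ∘ c, fun e he => ?_⟩
  obtain ⟨α, e', he', rfl, huniq⟩ := hc e he
  exact ⟨φ (c e'), e', he', rfl, fun e'' he'' hne h => huniq e'' he'' hne (φ.injective h)⟩

end Assembly

/-! ### Asymptotics -/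

theorem natCast_clog_two_le {n : ℕ} (hn : 1 ≤ n) : (Nat.clog 2 n : ℝ) ≤ Real.logb 2 n + 1 := by
  have h := Real.natCeil_logb_natCast 2 n
  have h0 : 0 ≤ Real.logb 2 (n : ℝ) :=
    Real.logb_nonneg one_lt_two (by exact_mod_cast hn)
  rw [← h]
  exact_mod_cast (Nat.ceil_lt_add_one h0).le

theorem exists_forall_cubic_clog_le (δ : ℝ) (hδ : 0 < δ) :
    ∃ K : ℕ, ∀ k ≥ K,
      (((16 * (Nat.clog 2 k + 8) + 1) * (128 * (Nat.clog 2 k + 8) ^ 2 + 1) : ℕ) : ℝ) ≤ δ * k := by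
  have hlo := (Real.isLittleO_pow_log_id_atTop (n := 3)).comp_tendsto
    tendsto_natCast_atTop_atTop (k := fun n : ℕ => (n : ℝ))
  obtain ⟨K, hK⟩ := Filter.eventually_atTop.1
    (hlo.def (show 0 < δ / (2193 * 11 ^ 3) by positivity))
  refine ⟨max K 3, fun k hk => ?_⟩
  have hk3 : (3 : ℝ) ≤ k := by exact_mod_cast (le_max_right K 3).trans hk
  have hlog : 1 ≤ Real.log k := by
    rw [Real.le_log_iff_exp_le (by linarith)]
    linarith [Real.exp_one_lt_d9]
  have hbound := hK k ((le_max_left K 3).trans hk)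
  simp only [Function.comp, Real.norm_eq_abs, id] at hbound
  rw [abs_of_nonneg (by positivity), abs_of_nonneg (by positivity)] at hbound
  set q : ℝ := (Nat.clog 2 k : ℝ) + 8 with hq
  have hq1 : 1 ≤ q := by
    have : (0 : ℝ) ≤ (Nat.clog 2 k : ℝ) := Nat.cast_nonneg _
    linarith
  have hqle : q ≤ 11 * Real.log k := by
    have h1 := natCast_clog_two_le (n := k) (by exact_mod_cast (by linarith : (1 : ℝ) ≤ k))
    have h2 : Real.logb 2 (k : ℝ) ≤ 2 * Real.log k := by
      rw [Real.logb, div_le_iff₀ (Real.log_pos one_lt_two)]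
      nlinarith [Real.log_two_gt_d9]
    linarith
  push_cast
  rw [← hq]
  calc (16 * q + 1) * (128 * q ^ 2 + 1) ≤ (17 * q) * (129 * q ^ 2) := by
        gcongr <;> nlinarith
    _ = 2193 * q ^ 3 := by ring
    _ ≤ 2193 * (11 * Real.log k) ^ 3 := by gcongr
    _ = 2193 * 11 ^ 3 * Real.log k ^ 3 := by ring
    _ ≤ 2193 * 11 ^ 3 * (δ / (2193 * 11 ^ 3) * k) := by gcongr
    _ = δ * k := by ring

end ConflictFree

theorem theorem1 (ε : ℝ) (hε : 0 < ε) :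
    ∃ Δε : ℕ, ∀ (V : Type*) [Fintype V] (G : SimpleGraph V) [DecidableRel G.Adj],
      Δε ≤ G.maxDegree →
        (ConflictFree.chromaticIndex G : ℝ) ≤ (1 + ε) * Real.logb 2 (G.maxDegree : ℝ) := by
  -- With `k ≤ log₂ Δ + 2`, the bound `(1 + ε / 2) * k` suffices once `log₂ Δ ≥ (4 + 2 * ε) / ε`.
  obtain ⟨K, hK⟩ := ConflictFree.exists_forall_cubic_clog_le (ε / 2) (by positivity)
  obtain ⟨K', hK'⟩ := exists_nat_ge ((4 + 2 * ε) / ε)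
  refine ⟨2 ^ max K K', fun V _ G _ hΔ => ?_⟩
  set Δ := G.maxDegree
  set k := Nat.clog 2 (2 * Δ) with hk
  have hΔ1 : 1 ≤ Δ := Nat.one_le_two_pow.trans hΔ
  have hpow : 2 * Δ ≤ 2 ^ k := Nat.le_pow_clog one_lt_two _
  have hmax : max K K' + 1 ≤ k := by
    rw [← Nat.pow_le_pow_iff_right (a := 2) one_lt_two, pow_succ]
    omega
  have hcol := ConflictFree.chromaticIndex_le G k (Nat.clog 2 k + 6) hpow (by
    have h1 : k ≤ 2 ^ Nat.clog 2 k := Nat.le_pow_clog one_lt_two _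
    have h2 : Nat.clog 2 k ≤ k := Nat.clog_le_of_le_pow Nat.lt_two_pow_self.le
    rw [pow_add]
    omega)
  have hx : (K' : ℝ) ≤ Real.logb 2 Δ := by
    rw [Real.le_logb_iff_rpow_le one_lt_two (by exact_mod_cast hΔ1), Real.rpow_natCast]
    exact_mod_cast (Nat.pow_le_pow_right two_pos (le_max_right K K')).trans hΔ
  have hkx : (k : ℝ) ≤ Real.logb 2 Δ + 2 := by
    have h := ConflictFree.natCast_clog_two_le (n := 2 * Δ) (by omega)
    have hΔ0 : (Δ : ℝ) ≠ 0 := by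
      have : (1 : ℝ) ≤ Δ := by exact_mod_cast hΔ1
      positivity
    rw [Nat.cast_mul, Nat.cast_ofNat, Real.logb_mul two_ne_zero hΔ0,
      Real.logb_self_eq_one one_lt_two] at h
    linarith
  have hrest := hK k (by omega)
  have hcol' : (ConflictFree.chromaticIndex G : ℝ) ≤ k + ε / 2 * k := by
    refine le_trans ?_ (add_le_add_right hrest (k : ℝ))
    exact_mod_cast hcol
  have hlarge : 4 + 2 * ε ≤ ε * Real.logb 2 Δ := by
    have := (div_le_iff₀ hε).1 (hK'.trans hx)
    linarith
  nlinarith
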